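/- Solitaire memory is played with a deck of $2n$ cards labelled by $1,\dots,n$, each label appearing on exactly two cards. The deck is shuffled (all arrangements of the multiset $\{1,1,2,2,\dots,n,n\}$ in a row being equally likely) and the cards are laid face down in a row. A move consists of flipping first one card and then a second; if they match they are removed, and otherwise they are turned face down again. The game ends when all cards have been removed, and its length is the total number of moves. The player has perfect memory and makes each move by the following strategy. If the positions of both cards of a pair on the table are known (both have been flipped before), she flips and removes them. Otherwise she flips the leftmost card that has never been flipped; if the position of its mate is known, she flips the mate and removes both; if not, she flips the next leftmost card that has never been flipped, and removes the two cards if they happen to match. Then the expected length of a game with $2n$ cards is $$(3-2\ln 2)\,n+\frac78-2\ln 2+\varepsilon_n,$$ where $\lim_{n\to\infty}\varepsilon_n=0$; moreover $\varepsilon_n=O(1/\sqrt n)$ as $n\to\infty$. -/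

import Mathlib

namespace SolitaireMemory

/-- A deal of a deck of `2 * n` cards: a row of `2 * n` labels in which each of the `n` labels
occurs exactly twice, i.e. an arrangement of the multiset `{1, 1, 2, 2, …, n, n}`. -/
abbrev Deal (n : ℕ) : Type :=
  {σ : Fin (2 * n) → Fin n // ∀ a : Fin n, (Finset.univ.filter fun i => σ i = a).card = 2}

/-- The number of moves still to be made by a player with perfect memory who follows the strategy
below. Here `known` lists the cards that are still on the table and have been flipped before, and
`unknown` is the row, from left to right, of the cards that have never been flipped. The value is
the total number of moves from this situation on; every move contributes one summand `1`.

* If both cards of a pair are known, they are flipped and removed.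
* Otherwise the leftmost unknown card `x` is flipped. If its mate is known, the mate is flipped and
  both are removed. If not, the next unknown card `y` is flipped; the two cards are removed if they
  match, and are turned back (and remembered) if they do not.

The case of a single unknown card without a known mate never arises from a deal. -/
def movesLeft {α : Type*} [DecidableEq α] (known unknown : List α) : ℕ :=
  match h : known.find? (fun a => 2 ≤ known.count a) with
  | some a => 1 + movesLeft ((known.erase a).erase a) unknown
  | none =>
    match unknown with
    | [] => 0
    | x :: rest =>
      if x ∈ known then 1 + movesLeft (known.erase x) rest
      else
        match rest with
        | [] => 1
        | y :: rest' =>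
          if x = y then 1 + movesLeft known rest'
          else 1 + movesLeft (x :: y :: known) rest'
  termination_by known.length + 2 * unknown.length
  decreasing_by
    · have ha : a ∈ known := List.mem_of_find?_eq_some h
      have h1 := List.length_erase_of_mem ha
      have h2 := List.length_pos_of_mem ha
      have h3 := (List.erase_sublist (a := a) (l := known.erase a)).length_le
      omega
    · have h3 := (List.erase_sublist (a := x) (l := known)).length_le
      simp only [List.length_cons]
      omega
    · simp only [List.length_cons]
      omega
    · simp only [List.length_cons]
      omega

/-- The length of the game played on a deal: at the start no card is known. -/
def gameLength {n : ℕ} (σ : Deal n) : ℕ :=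
  movesLeft [] (List.ofFn σ.1)

/-- The expected length of a game with `2 * n` cards, all deals being equally likely. -/
noncomputable def expectedLength (n : ℕ) : ℝ :=
  (∑ σ : Deal n, (gameLength σ : ℝ)) / (Fintype.card (Deal n) : ℝ)

end SolitaireMemory

/-! Call an unknown card new if its label is not known when its turn in the row comes, old
otherwise. A state with `k` known cards and `j` untouched pairs shows `k + j` old and `j` new cards,
and each old card ends a run of `R ≥ 0` new ones. Such a block costs `⌈R/2⌉ + 1` moves, one fewer if
the last move of the run is a lucky match. Exactly `⌊R/2⌋ + 1` places of the block see an even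
number of new cards ahead before the next old card, and the end of the row adds one more;
`altWindow` is the expected number of these places. Summing over blocks gives `2k + 3j + 1 -
altWindow - luckyMatches`, which is `expMoves`. The proof checks this formula against the
recurrences of the strategy and carries it over to deals by induction (`sum_movesLeft`).

For `k = 0`, `normWindow n` is `altWindow 0 n / (2n + 1)` and also the expected number of lucky
matches with `n + 1` pairs. It tends to `log 2`, as its terms tend to those of the alternating
harmonic series. Its increments are governed by `altRun`, which obeys a first-order recurrence;
hence `normWindow n = log 2 + 1/(8(2n+1)) + O(1/n²)`, and the error in the theorem is even `O(1/n)`.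
-/

namespace SolitaireMemory

open Finset Filter Topology

/-! ### Runs and windows of new cards -/

/-- The probability that the next `l` unknown cards all carry new labels, when `k` cards are known
and `j` pairs are entirely unknown. -/
noncomputable def runProb (k j l : ℕ) : ℝ :=
  ∏ i ∈ range l, 2 * ((j : ℝ) - i) / ((k : ℝ) + 2 * j - i)

/-- The alternating sum of the probabilities `runProb`. -/
noncomputable def altRun (k j : ℕ) : ℝ :=
  ∑ l ∈ range (j + 1), (-1 : ℝ) ^ l * runProb k j l

/-- The expected number of windows of `l` consecutive unknown cards all carrying new labels. -/
noncomputable def windowCount (k j l : ℕ) : ℝ :=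
  runProb k j l * ((k : ℝ) + 2 * j - l + 1) / ((l : ℝ) + 1)

/-- The alternating sum of the numbers `windowCount`. -/
noncomputable def altWindow (k j : ℕ) : ℝ :=
  ∑ l ∈ range (j + 1), (-1 : ℝ) ^ l * windowCount k j l

theorem runProb_zero (k j : ℕ) : runProb k j 0 = 1 := by simp [runProb]

theorem runProb_succ (k j l : ℕ) :
    runProb k j (l + 1) = runProb k j l * (2 * ((j : ℝ) - l) / ((k : ℝ) + 2 * j - l)) := by
  rw [runProb, prod_range_succ, runProb]

theorem runProb_eq_zero {k j l : ℕ} (h : j < l) : runProb k j l = 0 :=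
  prod_eq_zero (mem_range.2 h) (by simp)

theorem runProb_succ_succ (k j l : ℕ) :
    runProb k (j + 1) (l + 1) =
      2 * ((j : ℝ) + 1) / ((k : ℝ) + 2 * j + 2) * runProb (k + 1) j l := by
  rw [runProb, prod_range_succ', runProb, mul_comm]
  congr 1
  · push_cast; ring
  · refine prod_congr rfl fun i _ => ?_
    push_cast
    congr 1 <;> ring

/-- The ratio is the probability that one additional known-label card avoids the first `l` places.
-/
theorem runProb_succ_left (k j : ℕ) {l : ℕ} (h : l ≤ j) :
    runProb k j l * ((k : ℝ) + 1 + 2 * j - l) = runProb (k + 1) j l * ((k : ℝ) + 1 + 2 * j) := by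
  induction l with
  | zero => simp [runProb_zero]
  | succ l ih =>
    have ih := ih (by omega)
    have hl : (l : ℝ) + 1 ≤ j := by exact_mod_cast h
    have hk : (0 : ℝ) ≤ k := by positivity
    have h0 : (0 : ℝ) ≤ l := by positivity
    have h1 : (k : ℝ) + 2 * j - l ≠ 0 := by intro h; linarith
    have h2 : (k : ℝ) + 1 + 2 * j - l ≠ 0 := by intro h; linarith
    rw [runProb_succ, runProb_succ]
    push_cast
    field_simp
    linear_combination ((j : ℝ) - l) * ((k : ℝ) + 2 * j - l) * ih

theorem runProb_succ_right (k j : ℕ) {l : ℕ} (h : l ≤ j + 1) :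
    ((j : ℝ) + 1 - l) * ((k : ℝ) + 2 * j + 2) * runProb k (j + 1) l =
      ((j : ℝ) + 1) * ((k : ℝ) + 2 * j + 2 - l) * runProb (k + 1) j l := by
  have hl : (l : ℝ) ≤ j + 1 := by exact_mod_cast h
  have hk : (0 : ℝ) ≤ k := by positivity
  have hj : (0 : ℝ) ≤ j := by positivity
  have h1 : (k : ℝ) + 2 * j + 2 - l ≠ 0 := by intro h; linarith
  have h2 : (k : ℝ) + 2 * j + 2 ≠ 0 := by positivity
  have e := runProb_succ_succ k j l
  rw [runProb_succ] at e
  push_cast at e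
  rw [show (k : ℝ) + 2 * (j + 1) - l = k + 2 * j + 2 - l by ring] at e
  field_simp at e
  linear_combination e

theorem altRun_zero (k : ℕ) : altRun k 0 = 1 := by simp [altRun, runProb_zero]

/-- `altRun` is the probability that the initial run of new cards has even length. A new first card
reverses the parity of what follows; an old one makes the run empty. -/
theorem altRun_succ (k j : ℕ) :
    ((k : ℝ) + 2 * j + 2) * altRun k (j + 1) + 2 * ((j : ℝ) + 1) * altRun (k + 1) j =
      (k : ℝ) + 2 * j + 2 := by
  have h2 : (k : ℝ) + 2 * j + 2 ≠ 0 := by positivity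
  rw [altRun, sum_range_succ', altRun]
  simp only [runProb_succ_succ, runProb_zero, pow_succ]
  rw [show ∑ x ∈ range (j + 1), (-1 : ℝ) ^ x * -1 *
      (2 * ((j : ℝ) + 1) / ((k : ℝ) + 2 * j + 2) * runProb (k + 1) j x) =
      -(2 * ((j : ℝ) + 1) / ((k : ℝ) + 2 * j + 2)) *
        ∑ x ∈ range (j + 1), (-1 : ℝ) ^ x * runProb (k + 1) j x by
    rw [mul_sum]; exact sum_congr rfl fun _ _ => by ring]
  field_simp
  ring

theorem altWindow_zero (k : ℕ) : altWindow k 0 = k + 1 := by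
  simp [altWindow, windowCount, runProb_zero]

theorem altWindow_eq_sum_succ (k j : ℕ) :
    altWindow k j = ∑ l ∈ range (j + 2), (-1 : ℝ) ^ l * windowCount k j l := by
  rw [sum_range_succ _ (j + 1), altWindow, windowCount, runProb_eq_zero (Nat.lt_succ_self j)]
  simp

theorem windowCount_mul (k j l : ℕ) :
    ((l : ℝ) + 1) * windowCount k j l = runProb k j l * ((k : ℝ) + 2 * j - l + 1) := by
  rw [windowCount]; field_simp

theorem windowCount_zero_left (j : ℕ) {l : ℕ} (h : l ≤ j + 1) :
    (2 * (j : ℝ) + 2) * windowCount 0 (j + 1) l =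
      (2 * (j : ℝ) + 2) * runProb 0 (j + 1) l + 2 * ((j : ℝ) + 1) * windowCount 1 j l := by
  have e := runProb_succ_right 0 j h
  have e1 := windowCount_mul 0 (j + 1) l
  have e2 := windowCount_mul 1 j l
  have h2 : (l : ℝ) + 1 ≠ 0 := by positivity
  refine mul_left_cancel₀ h2 ?_
  push_cast at e e1 e2
  linear_combination 2 * e + (2 * (j : ℝ) + 2) * e1 - 2 * ((j : ℝ) + 1) * e2

/-- Condition on the first card: windows starting there contribute `runProb`, all others are windows
of the remaining row. -/
theorem windowCount_succ_left (k j : ℕ) {l : ℕ} (h : l ≤ j + 1) :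
    ((k : ℝ) + 2 * j + 3) * windowCount (k + 1) (j + 1) l =
      ((k : ℝ) + 2 * j + 3) * runProb (k + 1) (j + 1) l
        + ((k : ℝ) + 1) * windowCount k (j + 1) l
        + 2 * ((j : ℝ) + 1) * windowCount (k + 2) j l := by
  have e := runProb_succ_right (k + 1) j h
  have e' := runProb_succ_left k (j + 1) h
  have e1 := windowCount_mul (k + 1) (j + 1) l
  have e2 := windowCount_mul k (j + 1) l
  have e3 := windowCount_mul (k + 2) j l
  have h2 : (l : ℝ) + 1 ≠ 0 := by positivity
  refine mul_left_cancel₀ h2 ?_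
  push_cast at e e' e1 e2 e3
  linear_combination 2 * e - ((k : ℝ) + 1) * e' + ((k : ℝ) + 2 * j + 3) * e1
    - ((k : ℝ) + 1) * e2 - 2 * ((j : ℝ) + 1) * e3

theorem altWindow_zero_left (j : ℕ) :
    altWindow 0 (j + 1) = altRun 0 (j + 1) + altWindow 1 j := by
  rw [altWindow_eq_sum_succ 1, altRun, altWindow, ← sum_add_distrib]
  refine sum_congr rfl fun l hl => ?_
  have e := windowCount_zero_left j (l := l) (by have := mem_range.1 hl; omega)
  have h : (2 * (j : ℝ) + 2) ≠ 0 := by positivity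
  have e' : windowCount 0 (j + 1) l = runProb 0 (j + 1) l + windowCount 1 j l :=
    mul_left_cancel₀ h (by linear_combination e)
  rw [e']; ring

theorem altWindow_succ_succ (k j : ℕ) :
    ((k : ℝ) + 2 * j + 3) * altWindow (k + 1) (j + 1) =
      ((k : ℝ) + 2 * j + 3) * altRun (k + 1) (j + 1) + ((k : ℝ) + 1) * altWindow k (j + 1)
        + 2 * ((j : ℝ) + 1) * altWindow (k + 2) j := by
  rw [altWindow_eq_sum_succ (k + 2), altRun, altWindow, altWindow]
  simp only [mul_sum]
  rw [← sum_add_distrib, ← sum_add_distrib]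
  refine sum_congr rfl fun l hl => ?_
  have e := windowCount_succ_left k j (l := l) (by have := mem_range.1 hl; omega)
  linear_combination (-1 : ℝ) ^ l * e

/-! ### Closed formula for the expected number of moves -/

/-- The expected number of pairs removed by flipping two new cards that happen to match. -/
noncomputable def luckyMatches (k : ℕ) : ℕ → ℝ
  | 0 => 0
  | j + 1 => 2 * ((j : ℝ) + 1) / (((k : ℝ) + 2 * j + 2) * ((k : ℝ) + 2 * j + 1)) * altWindow k j

/-- The expected number of moves when `k` cards are known and `j` pairs are entirely unknown. -/
noncomputable def expMoves (k j : ℕ) : ℝ :=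
  2 * k + 3 * j + 1 - altWindow k j - luckyMatches k j

/-- The expected number of moves, the current one included, when `k + 1` cards are known, `j` pairs
are entirely unknown and the first card of the current move is one of the known cards. -/
noncomputable def expMovesPending (k j : ℕ) : ℝ :=
  expMoves (k + 1) j + altRun (k + 1) j - altRun k j / ((k : ℝ) + 1 + 2 * j)

/-- `luckyMatches` inserts an adjacent pair into a gap of a row with one pair fewer. The match is
lucky when the run just before the gap is even; windows counted by their right end give `altWindow`
again. -/
theorem luckyMatches_zero_left (j : ℕ) :
    luckyMatches 0 (j + 1) = luckyMatches 1 j + altRun 0 j / (2 * (j : ℝ) + 1) := by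
  rcases j with _ | j
  · simp [luckyMatches, altWindow_zero, altRun_zero]
  · simp only [luckyMatches, altWindow_zero_left]
    push_cast
    field_simp
    ring

theorem luckyMatches_succ_left (k j : ℕ) :
    ((k : ℝ) + 2 * j + 3) * luckyMatches (k + 1) (j + 1) =
      ((k : ℝ) + 1) * luckyMatches k (j + 1)
       + 2 * ((j : ℝ) + 1) * (luckyMatches (k + 2) j + altRun (k + 1) j / ((k : ℝ) + 2 + 2 * j)) := by
  rcases j with _ | j
  · simp [luckyMatches, altWindow_zero, altRun_zero]
    field_simp
    ring
  · simp only [luckyMatches]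
    have e := altWindow_succ_succ k j
    push_cast
    have h1 : (k : ℝ) + 1 + 2 * (j + 1) + 2 ≠ 0 := by positivity
    have h2 : (k : ℝ) + 1 + 2 * (j + 1) + 1 ≠ 0 := by positivity
    have h3 : (k : ℝ) + 2 * (j + 1) + 2 ≠ 0 := by positivity
    have h4 : (k : ℝ) + 2 * (j + 1) + 1 ≠ 0 := by positivity
    have h5 : (k : ℝ) + 2 + 2 * j + 2 ≠ 0 := by positivity
    have h6 : (k : ℝ) + 2 + 2 * j + 1 ≠ 0 := by positivity
    have h7 : (k : ℝ) + 2 + 2 * (j + 1) ≠ 0 := by positivity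
    have e' : altWindow (k + 1) (j + 1) = (((k : ℝ) + 2 * j + 3) * altRun (k + 1) (j + 1)
        + ((k : ℝ) + 1) * altWindow k (j + 1)
        + 2 * ((j : ℝ) + 1) * altWindow (k + 2) j) / ((k : ℝ) + 2 * j + 3) := by
      rw [← e]; field_simp
    rw [e']
    field_simp
    ring

theorem expMoves_zero_zero : expMoves 0 0 = 0 := by
  simp [expMoves, altWindow_zero, luckyMatches]

theorem expMoves_succ_zero (k : ℕ) : expMoves (k + 1) 0 = 1 + expMoves k 0 := by
  simp [expMoves, altWindow_zero, luckyMatches]; ring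

theorem expMoves_zero_succ (j : ℕ) : expMoves 0 (j + 1) = expMovesPending 0 j := by
  have e := altRun_succ 0 j
  have h : (2 * (j : ℝ) + 2) ≠ 0 := by positivity
  have e' : altRun 0 (j + 1) + altRun 1 j = 1 := by
    refine mul_left_cancel₀ h ?_
    push_cast at e
    linear_combination e
  simp only [expMoves, expMovesPending, altWindow_zero_left, luckyMatches_zero_left]
  push_cast
  rw [show (0 : ℝ) + 1 + 2 * j = 2 * j + 1 by ring]
  linear_combination -e'

theorem expMoves_succ_succ (k j : ℕ) :
    ((k : ℝ) + 2 * j + 3) * expMoves (k + 1) (j + 1) =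
      ((k : ℝ) + 1) * (1 + expMoves k (j + 1)) + 2 * ((j : ℝ) + 1) * expMovesPending (k + 1) j := by
  have e := altRun_succ (k + 1) j
  have e1 := altWindow_succ_succ k j
  have e2 := luckyMatches_succ_left k j
  simp only [expMoves, expMovesPending]
  push_cast at e ⊢
  rw [show (k : ℝ) + 1 + 1 + 2 * j = k + 2 + 2 * j by ring]
  linear_combination -e - e1 - e2

theorem expMovesPending_zero (k : ℕ) :
    ((k : ℝ) + 1) * expMovesPending k 0 = (1 + expMoves k 0) + k * (2 + expMoves k 0) := by
  simp [expMovesPending, expMoves, altWindow_zero, luckyMatches, altRun_zero]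
  field_simp
  ring

/-- The second card matches the first, or matches an older known card (which costs an extra move),
or is new. In `expMovesPending`, the pending card shifts the parity of the run: one more move when
the run is even, which gives `altRun (k + 1) j`. The signed change in lucky matches at the end of
the run is `altRun k j / (k + 1 + 2j)`, by `runProb_succ_left`. -/
theorem expMovesPending_succ (k j : ℕ) :
    ((k : ℝ) + 2 * j + 3) * expMovesPending k (j + 1) =
      (1 + expMoves k (j + 1)) + k * (2 + expMoves k (j + 1))
        + 2 * ((j : ℝ) + 1) * (1 + expMoves (k + 2) j) := by
  have e := expMoves_succ_succ k j
  have e1 := altRun_succ (k + 1) j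
  have e2 := altRun_succ k j
  simp only [expMovesPending] at e ⊢
  push_cast at e e1 e2 ⊢
  have h1 : (k : ℝ) + 1 + 2 * (j + 1) ≠ 0 := by positivity
  have h2 : (k : ℝ) + 1 + 1 + 2 * j ≠ 0 := by positivity
  have e3 : altRun k (j + 1) = 1 - 2 * ((j : ℝ) + 1) * (altRun (k + 1) j / (k + 1 + 1 + 2 * j)) := by
    field_simp
    linear_combination e2
  rw [mul_sub, mul_add, e, e3]
  set z := altRun (k + 1) j / ((k : ℝ) + 1 + 1 + 2 * j)
  rw [show ((k : ℝ) + 2 * j + 3) * ((1 - 2 * ((j : ℝ) + 1) * z) / (k + 1 + 2 * (j + 1)))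
    = 1 - 2 * ((j : ℝ) + 1) * z by field_simp; ring]
  linear_combination e1

/-! ### The strategy, move by move -/

section Moves

variable {α : Type*} [DecidableEq α]

theorem find_eq_none_of_nodup {K : List α} (hK : K.Nodup) :
    K.find? (fun a => 2 ≤ K.count a) = none := by
  rw [List.find?_eq_none]
  intro a _
  have := List.nodup_iff_count_le_one.1 hK a
  simp only [decide_eq_true_eq]
  omega

theorem movesLeft_nil {K : List α} (hK : K.Nodup) : movesLeft K [] = 0 := by
  rw [movesLeft.eq_def]
  split
  · next a h => rw [find_eq_none_of_nodup hK] at h; cases h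
  · rfl

theorem movesLeft_cons_of_mem {K : List α} (hK : K.Nodup) {x : α} (hx : x ∈ K) (l : List α) :
    movesLeft K (x :: l) = 1 + movesLeft (K.erase x) l := by
  rw [movesLeft.eq_def]
  split
  · next a h => rw [find_eq_none_of_nodup hK] at h; cases h
  · simp [hx]

theorem movesLeft_cons_cons_self {K : List α} (hK : K.Nodup) {x : α} (hx : x ∉ K) (l : List α) :
    movesLeft K (x :: x :: l) = 1 + movesLeft K l := by
  rw [movesLeft.eq_def]
  split
  · next a h => rw [find_eq_none_of_nodup hK] at h; cases h
  · simp [hx]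

theorem movesLeft_cons_cons {K : List α} (hK : K.Nodup) {x y : α} (hx : x ∉ K) (hxy : x ≠ y)
    (l : List α) : movesLeft K (x :: y :: l) = 1 + movesLeft (x :: y :: K) l := by
  rw [movesLeft.eq_def]
  split
  · next a h => rw [find_eq_none_of_nodup hK] at h; cases h
  · simp [hx, hxy]

/-- Since `K` has no duplicates, `y` is the only label known twice, so the search can only find `y`.
-/
theorem movesLeft_of_known_pair {K : List α} (hK : K.Nodup) {x y : α} (hx : x ∉ K) (hy : y ∈ K)
    (l : List α) : movesLeft (x :: y :: K) l = 1 + movesLeft (x :: K.erase y) l := by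
  have hxy : x ≠ y := fun h => hx (h ▸ hy)
  have hc : K.count y = 1 := List.count_eq_one_of_mem hK hy
  rw [movesLeft.eq_def]
  split
  · next a h =>
    have h1 := List.find?_some h
    simp only [decide_eq_true_eq, List.count_cons, beq_iff_eq] at h1
    have h2 := List.nodup_iff_count_le_one.1 hK a
    have hay : a = y := by
      by_contra hay
      have h3 : y ≠ a := fun h => hay h.symm
      by_cases hxa : x = a
      · subst hxa
        have := List.count_eq_zero_of_not_mem hx
        simp [h3, this] at h1
      · simp [h3, hxa] at h1
        omega
    subst hay
    simp [hxy]
  · next h =>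
    rw [List.find?_eq_none] at h
    have := h y (by simp)
    simp [List.count_cons, hc] at this

theorem movesLeft_cons_cons_of_mem {K : List α} (hK : K.Nodup) {x y : α} (hx : x ∉ K) (hy : y ∈ K)
    (l : List α) : movesLeft K (x :: y :: l) = 2 + movesLeft (x :: K.erase y) l := by
  rw [movesLeft_cons_cons hK hx (fun h => hx (h ▸ hy)), movesLeft_of_known_pair hK hx hy]
  ring

end Moves

/-! ### Counting the arrangements of the unknown cards -/

section Arrangements

variable {α : Type*} [DecidableEq α]

/-- The finite set of all arrangements of a multiset in a row. -/
def arrangements (s : Multiset α) : Finset (List α) := s.lists.toFinset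

theorem mem_arrangements {s : Multiset α} {l : List α} : l ∈ arrangements s ↔ (l : Multiset α) = s := by
  simp [arrangements, eq_comm]

theorem arrangements_zero : arrangements (0 : Multiset α) = {[]} := by
  ext l; simp [mem_arrangements]

theorem sum_arrangements {M : Type*} [AddCommMonoid M] {s : Multiset α} (hs : s ≠ 0)
    (F : List α → M) :
    ∑ l ∈ arrangements s, F l =
      ∑ x ∈ s.toFinset, ∑ l ∈ arrangements (s.erase x), F (x :: l) := by
  rw [Finset.sum_sigma']
  symm
  refine Finset.sum_bij (fun p _ => p.1 :: p.2) ?_ ?_ ?_ ?_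
  · rintro ⟨x, l⟩ h
    simp only [mem_sigma, Multiset.mem_toFinset, mem_arrangements] at h
    rw [mem_arrangements, ← Multiset.cons_coe, h.2, Multiset.cons_erase h.1]
  · rintro ⟨x, l⟩ _ ⟨x', l'⟩ _ h
    simp only [List.cons.injEq] at h
    obtain ⟨rfl, rfl⟩ := h
    rfl
  · intro l hl
    rw [mem_arrangements] at hl
    rcases l with _ | ⟨x, l⟩
    · exact absurd hl.symm hs
    · refine ⟨⟨x, l⟩, ?_, rfl⟩
      subst hl
      simp [mem_arrangements]
  · intros; rfl

/-- The multiset of unknown cards when the cards in `K` are known and both cards of each pair in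
`J` are unknown. -/
def unknownCards {β : Type*} (K : List β) (J : Finset β) : Multiset β := K + J.val + J.val

theorem toFinset_unknownCards (K : List α) (J : Finset α) :
    (unknownCards K J).toFinset = K.toFinset ∪ J := by
  ext a; simp [unknownCards]

theorem unknownCards_erase_known {K : List α} {x : α} (hx : x ∈ K) (J : Finset α) :
    (unknownCards K J).erase x = unknownCards (K.erase x) J := by
  have hx' : x ∈ (K : Multiset α) := hx
  rw [unknownCards, add_assoc, Multiset.erase_add_left_pos _ hx', Multiset.coe_erase,
    unknownCards, add_assoc]

theorem unknownCards_erase_new (K : List α) {x : α} {J : Finset α} (hx : x ∈ J) :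
    (unknownCards K J).erase x = unknownCards (x :: K) (J.erase x) := by
  have h : J.val = x ::ₘ (J.erase x).val := by
    rw [Finset.erase_val, Multiset.cons_erase (by exact hx)]
  rw [unknownCards, h, unknownCards, ← Multiset.cons_coe x K, Multiset.add_cons,
    Multiset.erase_cons_head, Multiset.add_cons, Multiset.cons_add, Multiset.cons_add,
    Multiset.cons_add]

theorem unknownCards_perm {β : Type*} {K K' : List β} (h : K.Perm K') (J : Finset β) :
    unknownCards K J = unknownCards K' J := by
  rw [unknownCards, unknownCards, Multiset.coe_eq_coe.2 h]

theorem unknownCards_ne_zero {β : Type*} {K : List β} {J : Finset β} (h : 0 < K.length + J.card) :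
    unknownCards K J ≠ 0 := by
  intro h0
  have := congrArg Multiset.card h0
  simp [unknownCards] at this
  simp [this] at h

theorem sum_unknownCards {M : Type*} [AddCommMonoid M] {K : List α} {J : Finset α}
    (hd : Disjoint K.toFinset J) (h : 0 < K.length + J.card) (F : List α → M) :
    ∑ l ∈ arrangements (unknownCards K J), F l =
      ∑ x ∈ K.toFinset, ∑ l ∈ arrangements (unknownCards (K.erase x) J), F (x :: l)
      + ∑ x ∈ J, ∑ l ∈ arrangements (unknownCards (x :: K) (J.erase x)), F (x :: l) := by
  rw [sum_arrangements (unknownCards_ne_zero h), toFinset_unknownCards, sum_union hd]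
  congr 1
  · refine sum_congr rfl fun x hx => ?_
    rw [unknownCards_erase_known (by simpa using hx)]
  · refine sum_congr rfl fun x hx => ?_
    rw [unknownCards_erase_new K hx]

/-- The number of arrangements of `k` single cards and `j` pairs. -/
noncomputable def numArr (k j : ℕ) : ℝ := (k + 2 * j).factorial / 2 ^ j

theorem numArr_pos (k j : ℕ) : 0 < numArr k j := by
  unfold numArr; positivity

theorem numArr_succ_left (k j : ℕ) : numArr (k + 1) j = ((k : ℝ) + 1 + 2 * j) * numArr k j := by
  rw [numArr, numArr, show k + 1 + 2 * j = (k + 2 * j) + 1 by ring, Nat.factorial_succ]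
  push_cast; ring

theorem numArr_succ_right (k j : ℕ) :
    2 * numArr k (j + 1) = ((k : ℝ) + 2 + 2 * j) * numArr (k + 1) j := by
  rw [numArr, numArr, show k + 2 * (j + 1) = (k + 1 + 2 * j) + 1 by ring, Nat.factorial_succ]
  push_cast; field_simp; ring

/-- Split by the first card. The truncated subtractions do no harm, since they occur only with
coefficient zero. -/
theorem numArr_recurrence {k j : ℕ} (h : 0 < k + j) :
    numArr k j = k * numArr (k - 1) j + j * numArr (k + 1) (j - 1) := by
  rcases k with _ | k <;> rcases j with _ | j
  · omega
  · have := numArr_succ_right 0 j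
    simp at this ⊢; linear_combination this / 2
  · have := numArr_succ_left k 0
    simp at this ⊢; exact this
  · have h1 := numArr_succ_right (k + 1) j
    have h2 := numArr_succ_left k (j + 1)
    simp only [add_tsub_cancel_right]
    push_cast at h1 h2 ⊢
    have h3 : (k : ℝ) + 1 + 2 * (j + 1) ≠ 0 := by positivity
    refine mul_left_cancel₀ h3 ?_
    linear_combination ((k : ℝ) + 1) * h2 + ((j : ℝ) + 1) * h1

theorem disjoint_erase_known {K : List α} {J : Finset α} (hd : Disjoint K.toFinset J) (x : α) :
    Disjoint (K.erase x).toFinset J :=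
  hd.mono_left fun a ha => by
    simp only [List.mem_toFinset] at ha ⊢; exact List.mem_of_mem_erase ha

theorem disjoint_cons_erase {K : List α} {J : Finset α} (hd : Disjoint K.toFinset J) (x : α) :
    Disjoint (x :: K).toFinset (J.erase x) := by
  rw [Finset.disjoint_left] at hd ⊢
  intro a ha
  simp only [List.toFinset_cons, mem_insert, List.mem_toFinset, mem_erase] at ha hd ⊢
  rintro ⟨h1, h2⟩
  rcases ha with h | h
  · exact h1 h
  · exact hd h h2

theorem nodup_cons_of_disjoint {K : List α} (hK : K.Nodup) {J : Finset α}
    (hd : Disjoint K.toFinset J) {x : α} (hx : x ∈ J) : (x :: K).Nodup :=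
  List.nodup_cons.2 ⟨fun h => Finset.disjoint_left.1 hd (by simpa using h) hx, hK⟩

theorem card_arrangements (K : List α) (J : Finset α) (hK : K.Nodup)
    (hd : Disjoint K.toFinset J) :
    ((arrangements (unknownCards K J)).card : ℝ) = numArr K.length J.card := by
  induction h : K.length + 2 * J.card using Nat.strong_induction_on generalizing K J with
  | _ N ih =>
    subst h
    by_cases h0 : 0 < K.length + J.card
    · rw [Finset.card_eq_sum_ones, sum_unknownCards hd h0, numArr_recurrence h0]
      simp only [← Finset.card_eq_sum_ones]
      push_cast
      congr 1
      · rw [Finset.sum_congr rfl (g := fun _ => numArr (K.length - 1) J.card), sum_const,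
          List.toFinset_card_of_nodup hK, nsmul_eq_mul]
        intro x hx
        have hx' : x ∈ K := by simpa using hx
        have h1 := List.length_pos_of_mem hx'
        rw [← List.length_erase_of_mem hx']
        exact ih _ (by rw [List.length_erase_of_mem hx']; omega) _ _ (hK.erase x)
          (disjoint_erase_known hd x) rfl
      · rw [Finset.sum_congr rfl (g := fun _ => numArr (K.length + 1) (J.card - 1)), sum_const,
          nsmul_eq_mul]
        intro x hx
        have h1 := Finset.card_pos.2 ⟨x, hx⟩
        have := ih _ (by rw [Finset.card_erase_of_mem hx]; simp only [List.length_cons]; omega)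
          (x :: K) (J.erase x) (nodup_cons_of_disjoint hK hd hx) (disjoint_cons_erase hd x) rfl
        rw [this, Finset.card_erase_of_mem hx, List.length_cons]
    · have hK0 : K = [] := List.length_eq_zero_iff.1 (by omega)
      have hJ0 : J = ∅ := Finset.card_eq_zero.1 (by omega)
      subst hK0 hJ0
      simp [unknownCards, arrangements_zero, numArr]

end Arrangements

/-! ### Summing the number of moves over all arrangements -/

section TotalMoves

variable {α : Type*} [DecidableEq α]

theorem sum_add_movesLeft {K : List α} {J : Finset α} (hK : K.Nodup) (hd : Disjoint K.toFinset J)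
    {E : ℝ} (c : ℕ)
    (h : ∑ l ∈ arrangements (unknownCards K J), (movesLeft K l : ℝ) = numArr K.length J.card * E) :
    ∑ l ∈ arrangements (unknownCards K J), ((c + movesLeft K l : ℕ) : ℝ) =
      numArr K.length J.card * (c + E) := by
  simp only [Nat.cast_add, sum_add_distrib, sum_const, nsmul_eq_mul, h,
    card_arrangements K J hK hd]
  ring

theorem numArr_mul_expMovesPending (k j : ℕ) :
    numArr (k + 1) j * expMovesPending k j =
      numArr k j * (1 + expMoves k j) + k * (numArr k j * (2 + expMoves k j))
        + j * (numArr (k + 2) (j - 1) * (1 + expMoves (k + 2) (j - 1))) := by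
  rcases j with _ | j
  · have e := expMovesPending_zero k
    rw [numArr_succ_left]
    simp only [Nat.cast_zero, mul_zero, add_zero, zero_mul]
    linear_combination numArr k 0 * e
  · have e := expMovesPending_succ k j
    have e1 := numArr_succ_left k (j + 1)
    have e2 := numArr_succ_right (k + 1) j
    simp only [add_tsub_cancel_right]
    push_cast at e1 e2 ⊢
    have h : (k : ℝ) + 2 * j + 3 ≠ 0 := by positivity
    have e3 : numArr k (j + 1) = numArr (k + 1) (j + 1) / (k + 2 * j + 3) := by
      field_simp; linear_combination -e1
    have e4 : numArr (k + 2) j = 2 * numArr (k + 1) (j + 1) / (k + 2 * j + 3) := by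
      field_simp; linear_combination -e2
    rw [e3, e4]
    field_simp
    linear_combination numArr (k + 1) (j + 1) * e

theorem numArr_mul_expMoves {k j : ℕ} (h : 0 < k + j) :
    numArr k j * expMoves k j =
      k * (numArr (k - 1) j * (1 + expMoves (k - 1) j))
        + j * (numArr (k + 1) (j - 1) * expMovesPending k (j - 1)) := by
  rcases k with _ | k <;> rcases j with _ | j
  · omega
  · have e := expMoves_zero_succ j
    have e1 := numArr_succ_right 0 j
    simp only [add_tsub_cancel_right]
    push_cast at e1 ⊢
    simp only [zero_mul, zero_add] at e1 ⊢
    rw [e]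
    linear_combination expMovesPending 0 j * e1 / 2
  · have e := expMoves_succ_zero k
    have e1 := numArr_succ_left k 0
    simp only [add_tsub_cancel_right]
    push_cast at e1 ⊢
    rw [e, e1]
    ring
  · have e := expMoves_succ_succ k j
    have e1 := numArr_succ_left k (j + 1)
    have e2 := numArr_succ_right (k + 1) j
    simp only [add_tsub_cancel_right]
    push_cast at e1 e2 ⊢
    have h : (k : ℝ) + 2 * j + 3 ≠ 0 := by positivity
    have e3 : numArr k (j + 1) = numArr (k + 1) (j + 1) / (k + 2 * j + 3) := by
      field_simp; linear_combination -e1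
    have e4 : numArr (k + 1 + 1) j = 2 * numArr (k + 1) (j + 1) / (k + 2 * j + 3) := by
      field_simp; linear_combination -e2
    rw [e3, e4]
    field_simp
    linear_combination numArr (k + 1) (j + 1) * e

/-- This is the half of the induction in which a move uses two unknown cards; hence the induction
hypothesis appears as an assumption. -/
theorem sum_movesLeft_pending {K : List α} {J : Finset α} (hK : K.Nodup)
    (hd : Disjoint K.toFinset J) {x : α} (hx : x ∈ J)
    (ih : ∀ (K' : List α) (J' : Finset α), K'.length + 2 * J'.card < K.length + 2 * J.card →
      K'.Nodup → Disjoint K'.toFinset J' →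
      ∑ l ∈ arrangements (unknownCards K' J'), (movesLeft K' l : ℝ) =
        numArr K'.length J'.card * expMoves K'.length J'.card) :
    ∑ l ∈ arrangements (unknownCards (x :: K) (J.erase x)), (movesLeft K (x :: l) : ℝ) =
      numArr (K.length + 1) (J.card - 1) * expMovesPending K.length (J.card - 1) := by
  have hxK := nodup_cons_of_disjoint hK hd hx
  have hxn : x ∉ K := (List.nodup_cons.1 hxK).1
  have hd' := disjoint_cons_erase hd x
  have hJ : (J.erase x).card = J.card - 1 := Finset.card_erase_of_mem hx
  have hJ0 : 0 < J.card := Finset.card_pos.2 ⟨x, hx⟩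
  have hdK : Disjoint K.toFinset (J.erase x) := hd.mono_right (Finset.erase_subset _ _)
  rw [sum_unknownCards hd' (by simp), numArr_mul_expMovesPending, List.toFinset_cons,
    Finset.sum_insert (by simpa using hxn), List.erase_cons_head]
  congr 1
  · congr 1
    · simp only [movesLeft_cons_cons_self hK hxn]
      rw [sum_add_movesLeft hK hdK 1 (ih _ _ (by omega) hK hdK), hJ, Nat.cast_one]
    · rw [Finset.sum_congr rfl (g := fun _ => numArr K.length (J.card - 1) *
        (2 + expMoves K.length (J.card - 1))), sum_const, List.toFinset_card_of_nodup hK,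
        nsmul_eq_mul]
      intro y hy
      have hy' : y ∈ K := by simpa using hy
      have hxy : x ≠ y := fun h => hxn (h ▸ hy')
      have hlen : (x :: K.erase y).length = K.length := by
        have := List.length_pos_of_mem hy'
        rw [List.length_cons, List.length_erase_of_mem hy']; omega
      have hn : (x :: K.erase y).Nodup :=
        List.nodup_cons.2 ⟨fun h => hxn (List.mem_of_mem_erase h), hK.erase y⟩
      have hd2 : Disjoint (x :: K.erase y).toFinset (J.erase x) :=
        disjoint_cons_erase (disjoint_erase_known hd y) x
      rw [List.erase_cons_tail (by simpa using hxy)]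
      simp only [movesLeft_cons_cons_of_mem hK hxn hy']
      rw [sum_add_movesLeft hn hd2 2 (ih _ _ (by rw [hlen]; omega) hn hd2), hJ, hlen]
      norm_num
  · rw [Finset.sum_congr rfl (g := fun _ => numArr (K.length + 2) (J.card - 1 - 1) *
        (1 + expMoves (K.length + 2) (J.card - 1 - 1))), sum_const, nsmul_eq_mul, hJ]
    intro y hy
    have hyJ : y ∈ J := Finset.mem_of_mem_erase hy
    have hyx : x ≠ y := (Finset.ne_of_mem_erase hy).symm
    have hn : (y :: x :: K).Nodup := nodup_cons_of_disjoint hxK hd' hy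
    -- Peeling off cards and playing the move list the two new labels in opposite orders.
    have hp : (y :: x :: K).Perm (x :: y :: K) := List.Perm.swap _ _ _
    have hd2 := disjoint_cons_erase hd' y
    rw [List.toFinset_eq_of_perm _ _ hp] at hd2
    have hn2 := hp.nodup_iff.1 hn
    have hJ2 : ((J.erase x).erase y).card = J.card - 1 - 1 := by
      rw [Finset.card_erase_of_mem hy, hJ]
    have hJ1 : 0 < (J.erase x).card := Finset.card_pos.2 ⟨y, hy⟩
    rw [unknownCards_perm hp]
    simp only [movesLeft_cons_cons hK hxn hyx]
    rw [sum_add_movesLeft hn2 hd2 1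
      (ih _ _ (by rw [hJ2]; simp only [List.length_cons]; omega) hn2 hd2), hJ2]
    simp

theorem sum_movesLeft (K : List α) (J : Finset α) (hK : K.Nodup) (hd : Disjoint K.toFinset J) :
    ∑ l ∈ arrangements (unknownCards K J), (movesLeft K l : ℝ) =
      numArr K.length J.card * expMoves K.length J.card := by
  induction h : K.length + 2 * J.card using Nat.strong_induction_on generalizing K J with
  | _ N ih =>
    subst h
    by_cases h0 : 0 < K.length + J.card
    · rw [sum_unknownCards hd h0, numArr_mul_expMoves h0]
      congr 1
      · rw [Finset.sum_congr rfl (g := fun _ => numArr (K.length - 1) J.card *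
          (1 + expMoves (K.length - 1) J.card)), sum_const, List.toFinset_card_of_nodup hK,
          nsmul_eq_mul]
        intro x hx
        have hx' : x ∈ K := by simpa using hx
        have h1 := List.length_pos_of_mem hx'
        have h2 := List.length_erase_of_mem hx'
        have hd' := disjoint_erase_known hd x
        simp only [movesLeft_cons_of_mem hK hx']
        rw [sum_add_movesLeft (hK.erase x) hd' 1
          (ih _ (by rw [h2]; omega) _ _ (hK.erase x) hd' rfl), h2, Nat.cast_one]
      · rw [Finset.sum_congr rfl (g := fun _ => numArr (K.length + 1) (J.card - 1) *
          expMovesPending K.length (J.card - 1)), sum_const, nsmul_eq_mul]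
        intro x hx
        exact sum_movesLeft_pending hK hd hx fun K' J' h hK' hd' => ih _ h K' J' hK' hd' rfl
    · have hK0 : K = [] := List.length_eq_zero_iff.1 (by omega)
      have hJ0 : J = ∅ := Finset.card_eq_zero.1 (by omega)
      subst hK0 hJ0
      simp [unknownCards, arrangements_zero, movesLeft_nil, expMoves_zero_zero]

end TotalMoves

/-! ### From deals to the closed formula -/

theorem count_ofFn {m n : ℕ} (σ : Fin m → Fin n) (a : Fin n) :
    (List.ofFn σ).count a = (univ.filter fun i => σ i = a).card := by
  rw [← Multiset.coe_count, ← Fin.univ_val_map, Multiset.count_map, Finset.card_def,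
    Finset.filter_val]
  simp only [eq_comm]

theorem sum_deal (n : ℕ) (F : List (Fin n) → ℝ) :
    ∑ σ : Deal n, F (List.ofFn σ.1) = ∑ l ∈ arrangements (unknownCards [] (univ : Finset (Fin n))), F l := by
  have key : ∀ l : List (Fin n), l ∈ arrangements (unknownCards [] (univ : Finset (Fin n))) ↔
      ∀ a, l.count a = 2 := by
    intro l
    rw [mem_arrangements, Multiset.ext]
    simp [unknownCards, Multiset.count_univ]
  refine Finset.sum_bij (fun σ _ => List.ofFn σ.1) ?_ ?_ ?_ ?_
  · intro σ _
    rw [key]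
    intro a
    rw [count_ofFn, σ.2 a]
  · intro σ _ τ _ h
    exact Subtype.ext (List.ofFn_injective h)
  · intro l hl
    have hlen : l.length = 2 * n := by
      have := congrArg Multiset.card (mem_arrangements.1 hl)
      simp [unknownCards] at this
      omega
    rw [key] at hl
    obtain ⟨σ, rfl⟩ : ∃ σ : Fin (2 * n) → Fin n, List.ofFn σ = l := by
      rw [← hlen]
      exact ⟨l.get, List.ofFn_get l⟩
    exact ⟨⟨σ, fun a => by rw [← count_ofFn, hl a]⟩, mem_univ _, rfl⟩
  · intros; rfl

theorem expectedLength_eq (n : ℕ) : expectedLength n = expMoves 0 n := by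
  have hd : Disjoint ([] : List (Fin n)).toFinset univ := by simp
  have h1 := sum_movesLeft ([] : List (Fin n)) univ List.nodup_nil hd
  have h2 := card_arrangements ([] : List (Fin n)) univ List.nodup_nil hd
  have h3 := sum_deal n fun l => (movesLeft [] l : ℝ)
  have h4 := sum_deal n fun _ => 1
  simp only [sum_const, nsmul_eq_mul, mul_one, card_univ] at h4
  rw [h2] at h4
  rw [h1] at h3
  simp only [expectedLength, gameLength]
  rw [h3, h4]
  simp only [List.length_nil, card_univ, Fintype.card_fin]
  rw [mul_div_cancel_left₀ _ (numArr_pos 0 n).ne']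

/-! ### Recurrences in the number of pairs -/

theorem runProb_zero_left_succ (n : ℕ) {l : ℕ} (h : l ≤ n + 1) :
    2 * ((n : ℝ) + 1 - l) * (2 * n + 1) * runProb 0 (n + 1) l =
      (2 * (n : ℝ) + 2 - l) * (2 * n + 1 - l) * runProb 0 n l := by
  rcases h.lt_or_eq with h | rfl
  · have e1 := runProb_succ_right 0 n (l := l) (by omega)
    have e2 := runProb_succ_left 0 n (l := l) (by omega)
    push_cast at e1 e2
    have h0 : (n : ℝ) + 1 ≠ 0 := by positivity
    refine mul_left_cancel₀ h0 ?_
    linear_combination (2 * (n : ℝ) + 1) * e1 - ((n : ℝ) + 1) * (2 * (n : ℝ) + 2 - l) * e2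
  · rw [runProb_eq_zero (Nat.lt_succ_self n)]
    push_cast; ring

/-- The alternating sum `altWindow 0 n`, divided by its first term. -/
noncomputable def normWindow (n : ℕ) : ℝ := altWindow 0 n / (2 * n + 1)

/-- Both sides are the expectation of `(-1) ^ R`, with `R` the length of the initial run. -/
theorem sum_alternating_runProb_sub (n : ℕ) :
    ∑ l ∈ range (n + 1), (-1 : ℝ) ^ l * (runProb 0 n l - runProb 0 n (l + 1)) =
      2 * altRun 0 n - 1 := by
  have e : altRun 0 n = ∑ l ∈ range (n + 2), (-1 : ℝ) ^ l * runProb 0 n l := by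
    rw [sum_range_succ, runProb_eq_zero (Nat.lt_succ_self n), altRun]; simp
  rw [sum_range_succ', runProb_zero] at e
  have e' : ∑ l ∈ range (n + 1), (-1 : ℝ) ^ l * (runProb 0 n l - runProb 0 n (l + 1)) =
      altRun 0 n + ∑ l ∈ range (n + 1), (-1 : ℝ) ^ (l + 1) * runProb 0 n (l + 1) := by
    rw [altRun, ← sum_add_distrib]
    exact sum_congr rfl fun l _ => by ring
  rw [e']
  linarith

/-- The identity already holds for each `l` separately. -/
theorem normWindow_succ (n : ℕ) :
    normWindow (n + 1) = normWindow n + (2 * altRun 0 (n + 1) - 1) / (2 * n + 3) := by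
  rw [← sum_alternating_runProb_sub, normWindow, normWindow, altWindow_eq_sum_succ 0 n, altWindow,
    sum_div, sum_div, sum_div, ← sum_add_distrib]
  refine sum_congr rfl fun l hl => ?_
  have hl' : l ≤ n + 1 := by have := mem_range.1 hl; omega
  have hr : (l : ℝ) ≤ n + 1 := by exact_mod_cast hl'
  have hn : (0 : ℝ) ≤ n := by positivity
  have h1 : 2 * ((n : ℝ) + 1) - l ≠ 0 := by intro h; linarith
  have e := runProb_zero_left_succ n hl'
  have e1 : windowCount 0 n l = 2 * ((n : ℝ) + 1 - l) * (2 * n + 1) * runProb 0 (n + 1) l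
      / ((2 * n + 2 - l) * (l + 1)) := by
    rw [windowCount, e]
    push_cast
    field_simp
    ring
  rw [e1, windowCount, runProb_succ]
  push_cast
  rw [show (0 : ℝ) + 2 * (n + 1) - l = 2 * n + 2 - l by ring]
  field_simp
  ring

theorem altRun_zero_left_succ (n : ℕ) :
    3 * (2 * (n : ℝ) + 1) * altRun 0 (n + 1) + (2 * n + 2) * altRun 0 n = 2 * (2 * n + 1) := by
  -- A certificate in the style of Zeilberger: the combined summand is `2n + 1` times the difference
  -- of `G`, with `G 0 = -2` and `G (n + 2) = 0`.
  set G : ℕ → ℝ := fun l =>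
    (-1) ^ l * runProb 0 (n + 1) l * ((l : ℝ) - 4 * (n + 1)) / (2 * (n + 1) - l) with hG
  have e : altRun 0 n = ∑ l ∈ range (n + 2), (-1 : ℝ) ^ l * runProb 0 n l := by
    rw [sum_range_succ, runProb_eq_zero (Nat.lt_succ_self n), altRun]; simp
  have hn : (0 : ℝ) ≤ n := by positivity
  have key : ∀ l ∈ range (n + 2),
      3 * (2 * (n : ℝ) + 1) * ((-1 : ℝ) ^ l * runProb 0 (n + 1) l)
        + (2 * n + 2) * ((-1 : ℝ) ^ l * runProb 0 n l) = (2 * n + 1) * (G (l + 1) - G l) := by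
    intro l hl
    have hl' : l ≤ n + 1 := by have := mem_range.1 hl; omega
    rcases hl'.lt_or_eq with h | rfl
    · have hr : (l : ℝ) ≤ n := by exact_mod_cast Nat.lt_succ_iff.1 h
      have h1 : 2 * ((n : ℝ) + 1) - l ≠ 0 := by intro h; linarith
      have h2 : 2 * (n : ℝ) + 1 - l ≠ 0 := by intro h; linarith
      have e := runProb_zero_left_succ n hl'
      have e1 : runProb 0 n l = 2 * ((n : ℝ) + 1 - l) * (2 * n + 1) * runProb 0 (n + 1) l
          / ((2 * n + 2 - l) * (2 * n + 1 - l)) := by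
        rw [e]; field_simp
      simp only [hG]
      rw [e1, runProb_succ]
      push_cast
      rw [show (0 : ℝ) + 2 * (n + 1) - l = 2 * n + 2 - l by ring,
        show (2 : ℝ) * (n + 1) - l = 2 * n + 2 - l by ring,
        show (2 : ℝ) * (n + 1) - (l + 1) = 2 * n + 1 - l by ring, pow_succ]
      field_simp
      ring
    · simp only [hG]
      rw [runProb_eq_zero (Nat.lt_succ_self n), runProb_eq_zero (Nat.lt_succ_self (n + 1))]
      push_cast
      rw [show (2 : ℝ) * (n + 1) - (n + 1) = n + 1 by ring]
      field_simp
      ring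
  rw [altRun, e, mul_sum, mul_sum, ← sum_add_distrib, sum_congr rfl key, ← mul_sum,
    sum_range_sub]
  simp only [hG]
  rw [runProb_eq_zero (Nat.lt_succ_self (n + 1)), runProb_zero]
  have : (n : ℝ) + 1 ≠ 0 := by positivity
  push_cast
  field_simp
  ring

/-- The recurrence multiplies the deviation by about `-1/3`, so only the inhomogeneous term of order
`1/n²` remains. The bound `8 / (n + 3) ^ 2` leaves room for the base case `3/4 ≤ 8/9` and makes the
final numerator a polynomial with positive coefficients. -/
theorem abs_altRun_le (n : ℕ) :
    |2 * altRun 0 (n + 1) - 1 + 1 / (4 * (2 * n + 1))| ≤ 8 / ((n : ℝ) + 3) ^ 2 := by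
  induction n with
  | zero =>
    have e := altRun_zero_left_succ 0
    rw [altRun_zero] at e
    norm_num at e ⊢
    rw [show altRun 0 1 = 0 by linarith]
    norm_num [abs_le]
  | succ n ih =>
    have e := altRun_zero_left_succ (n + 1)
    push_cast at e ⊢
    have hn : (0 : ℝ) ≤ n := by positivity
    set y : ℝ := 2 * altRun 0 (n + 1) - 1 + 1 / (4 * (2 * n + 1)) with hy
    have e' : 2 * altRun 0 (n + 1 + 1) - 1 + 1 / (4 * (2 * ((n : ℝ) + 1) + 1)) =
        1 / (4 * (2 * n + 3) * (2 * n + 1)) - (2 * n + 4) / (3 * (2 * n + 3)) * y := by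
      have e1 : altRun 0 (n + 1 + 1) = (2 * (2 * ((n : ℝ) + 1) + 1)
          - (2 * (n + 1) + 2) * altRun 0 (n + 1)) / (3 * (2 * (n + 1) + 1)) := by
        rw [← e]; field_simp; ring
      have e2 : altRun 0 (n + 1) = (y + 1 - 1 / (4 * (2 * n + 1))) / 2 := by rw [hy]; ring
      rw [e1, e2]
      field_simp
      ring
    rw [e']
    calc |1 / (4 * (2 * (n : ℝ) + 3) * (2 * n + 1)) - (2 * n + 4) / (3 * (2 * n + 3)) * y|
        ≤ |1 / (4 * (2 * (n : ℝ) + 3) * (2 * n + 1))| + |(2 * n + 4) / (3 * (2 * n + 3)) * y| :=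
          abs_sub _ _
      _ = 1 / (4 * (2 * (n : ℝ) + 3) * (2 * n + 1)) + (2 * n + 4) / (3 * (2 * n + 3)) * |y| := by
          rw [abs_of_nonneg (by positivity), abs_mul, abs_of_nonneg (a := (2 * (n : ℝ) + 4) / _)
            (by positivity)]
      _ ≤ 1 / (4 * (2 * (n : ℝ) + 3) * (2 * n + 1))
            + (2 * n + 4) / (3 * (2 * n + 3)) * (8 / ((n : ℝ) + 3) ^ 2) := by gcongr
      _ ≤ 8 / ((n : ℝ) + 1 + 3) ^ 2 := by
          rw [← sub_nonneg]
          have : 8 / ((n : ℝ) + 1 + 3) ^ 2 - (1 / (4 * (2 * (n : ℝ) + 3) * (2 * n + 1))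
            + (2 * n + 4) / (3 * (2 * n + 3)) * (8 / ((n : ℝ) + 3) ^ 2)) =
            (12 * 8 * (2 * n + 3) * (2 * n + 1) * (n + 3) ^ 2 - 3 * (n + 3) ^ 2 * (n + 4) ^ 2
              - 32 * (2 * n + 4) * (2 * n + 1) * (n + 4) ^ 2)
              / (12 * (2 * n + 3) * (2 * n + 1) * (n + 3) ^ 2 * (n + 4) ^ 2) := by
            field_simp; ring
          rw [this]
          refine div_nonneg ?_ (by positivity)
          ring_nf
          positivity

/-! ### The limit `log 2` -/

theorem tendsto_alternating_harmonic :
    Tendsto (fun m : ℕ => ∑ i ∈ range m, (-1 : ℝ) ^ i * (1 / ((i : ℝ) + 1))) atTop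
      (𝓝 (Real.log 2)) := by
  have hanti : Antitone fun i : ℕ => 1 / ((i : ℝ) + 1) :=
    fun i j h => one_div_le_one_div_of_le (by positivity) (by gcongr)
  obtain ⟨L, hL⟩ := hanti.tendsto_alternating_series_of_tendsto_zero
    tendsto_one_div_add_atTop_nhds_zero_nat
  -- In the difference of harmonic numbers the logarithms leave `log 2` and Euler's constant
  -- cancels.
  have hsum : ∀ m : ℕ, ∑ i ∈ range (2 * m), (-1 : ℝ) ^ i * (1 / ((i : ℝ) + 1)) =
      (harmonic (2 * m) : ℝ) - harmonic m := by
    intro m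
    induction m with
    | zero => simp
    | succ m ih =>
      rw [show 2 * (m + 1) = 2 * m + 1 + 1 by ring, sum_range_succ, sum_range_succ, ih,
        harmonic_succ, harmonic_succ, harmonic_succ, pow_succ, pow_mul]
      push_cast
      norm_num
      field_simp
      ring
  have h2 : Tendsto (fun m : ℕ => 2 * m) atTop atTop :=
    tendsto_id.const_mul_atTop' (by norm_num)
  have h3 := ((Real.tendsto_harmonic_sub_log.comp h2).sub Real.tendsto_harmonic_sub_log).add_const
    (Real.log 2)
  rw [sub_self, zero_add] at h3
  have h4 : Tendsto (fun m : ℕ => ∑ i ∈ range (2 * m), (-1 : ℝ) ^ i * (1 / ((i : ℝ) + 1))) atTop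
      (𝓝 (Real.log 2)) := by
    refine h3.congr' ?_
    filter_upwards [eventually_gt_atTop 0] with m hm
    have hm' : (m : ℝ) ≠ 0 := by positivity
    simp only [Function.comp_apply]
    rw [hsum]
    push_cast
    rw [Real.log_mul two_ne_zero hm']
    ring
  rwa [tendsto_nhds_unique (hL.comp h2) h4] at hL

theorem runProb_nonneg (n l : ℕ) : 0 ≤ runProb 0 n l := by
  rcases lt_or_ge n l with h | h
  · rw [runProb_eq_zero h]
  · refine prod_nonneg fun i hi => ?_
    have : (i : ℝ) ≤ n := by exact_mod_cast (mem_range.1 hi).le.trans h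
    have hn : (0 : ℝ) ≤ n := by positivity
    push_cast
    exact div_nonneg (by linarith) (by linarith)

theorem antitone_windowCount (n : ℕ) : Antitone (windowCount 0 n) := by
  refine antitone_nat_of_succ_le fun l => ?_
  have hn : (0 : ℝ) ≤ n := by positivity
  have hl0 : (0 : ℝ) ≤ l := by positivity
  have hq := runProb_nonneg n l
  rcases lt_or_ge l n with h | h
  · have hl : (l : ℝ) + 1 ≤ n := by exact_mod_cast h
    have hs : runProb 0 n (l + 1) ≤ runProb 0 n l := by
      rw [runProb_succ]
      refine mul_le_of_le_one_right hq ?_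
      push_cast
      rw [div_le_one (by linarith)]
      linarith
    simp only [windowCount]
    push_cast
    refine div_le_div₀ (mul_nonneg hq (by linarith)) ?_ (by positivity) (by linarith)
    exact mul_le_mul hs (by linarith) (by linarith) hq
  · have h0 : windowCount 0 n (l + 1) = 0 := by
      rw [windowCount, runProb_eq_zero (by omega)]; simp
    rw [h0, windowCount]
    rcases h.eq_or_lt with rfl | h
    · push_cast
      exact div_nonneg (mul_nonneg hq (by linarith)) (by positivity)
    · rw [runProb_eq_zero h]; simp

theorem tendsto_sum_windowCount (n : ℕ) :
    Tendsto (fun m : ℕ => ∑ l ∈ range m, (-1 : ℝ) ^ l * windowCount 0 n l) atTop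
      (𝓝 (altWindow 0 n)) := by
  refine tendsto_const_nhds.congr' ?_
  filter_upwards [eventually_ge_atTop (n + 1)] with m hm
  refine sum_subset (range_subset_range.2 hm) fun l _ hl => ?_
  rw [windowCount, runProb_eq_zero (by simpa using hl)]
  simp

theorem tendsto_inv_two_mul_add (c : ℝ) : Tendsto (fun n : ℕ => (2 * (n : ℝ) + c)⁻¹) atTop (𝓝 0) :=
  (tendsto_atTop_add_const_right _ _
    (tendsto_natCast_atTop_atTop.const_mul_atTop two_pos)).inv_tendsto_atTop

theorem tendsto_runProb (l : ℕ) : Tendsto (fun n : ℕ => runProb 0 n l) atTop (𝓝 1) := by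
  have : ∀ i ∈ range l, Tendsto
      (fun n : ℕ => 2 * ((n : ℝ) - i) / (((0 : ℕ) : ℝ) + 2 * n - i)) atTop (𝓝 1) := by
    intro i _
    have h := ((tendsto_inv_two_mul_add (-i)).const_mul (i : ℝ)).const_sub 1
    rw [mul_zero, sub_zero] at h
    refine h.congr' ?_
    filter_upwards [eventually_gt_atTop i] with n hn
    have hn' : (i : ℝ) < n := by exact_mod_cast hn
    have hi : (0 : ℝ) ≤ i := by positivity
    have h1 : 2 * (n : ℝ) + -i ≠ 0 := by intro h; linarith
    have h2 : (0 : ℝ) + 2 * n - i ≠ 0 := by intro h; linarith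
    push_cast
    rw [show (0 : ℝ) + 2 * n - i = 2 * n + -i by ring]
    field_simp
    ring
  have h := tendsto_finsetProd _ this
  rw [prod_const_one] at h
  exact h

theorem tendsto_windowCount_div (l : ℕ) :
    Tendsto (fun n : ℕ => windowCount 0 n l / (2 * n + 1)) atTop (𝓝 (1 / ((l : ℝ) + 1))) := by
  have h := ((tendsto_runProb l).mul
    (((tendsto_inv_two_mul_add 1).const_mul (l : ℝ)).const_sub 1)).div_const ((l : ℝ) + 1)
  rw [mul_zero, sub_zero, mul_one] at h
  refine h.congr fun n => ?_
  rw [windowCount]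
  push_cast
  field_simp
  ring

/-- The terms decrease in `l`, so even partial sums bound `normWindow` from below and odd ones from
above; this replaces a uniform estimate for exchanging limit and sum. -/
theorem tendsto_normWindow : Tendsto normWindow atTop (𝓝 (Real.log 2)) := by
  have hlim : ∀ m : ℕ, Tendsto
      (fun n : ℕ => (∑ l ∈ range m, (-1 : ℝ) ^ l * windowCount 0 n l) / (2 * n + 1)) atTop
      (𝓝 (∑ l ∈ range m, (-1 : ℝ) ^ l * (1 / ((l : ℝ) + 1)))) := by
    intro m
    simp only [sum_div, mul_div_assoc]
    exact tendsto_finsetSum _ fun l _ => (tendsto_windowCount_div l).const_mul _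
  have h2 : Tendsto (fun m : ℕ => 2 * m) atTop atTop :=
    tendsto_id.const_mul_atTop' (by norm_num)
  have h3 : Tendsto (fun m : ℕ => 2 * m + 1) atTop atTop :=
    tendsto_atTop_mono (fun m => Nat.le_succ _) h2
  refine tendsto_order.2 ⟨fun a ha => ?_, fun a ha => ?_⟩
  · obtain ⟨k, hk⟩ := ((tendsto_alternating_harmonic.comp h2).eventually_const_lt ha).exists
    filter_upwards [(hlim (2 * k)).eventually_const_lt hk] with n hn
    refine hn.trans_le ?_
    rw [normWindow]
    gcongr
    exact (antitone_windowCount n).alternating_series_le_tendsto (tendsto_sum_windowCount n) k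
  · obtain ⟨k, hk⟩ := ((tendsto_alternating_harmonic.comp h3).eventually_lt_const ha).exists
    filter_upwards [(hlim (2 * k + 1)).eventually_lt_const hk] with n hn
    refine lt_of_le_of_lt ?_ hn
    rw [normWindow]
    gcongr
    exact (antitone_windowCount n).tendsto_le_alternating_series (tendsto_sum_windowCount n) k

/-! ### Rate of convergence and conclusion -/

/-- If the increments of a convergent sequence are bounded by the decrements of a null sequence,
then its distance to the limit is bounded by that null sequence. -/
theorem abs_sub_le_of_abs_succ_sub_le {w b : ℕ → ℝ} {L : ℝ} (hw : Tendsto w atTop (𝓝 L))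
    (hb : Tendsto b atTop (𝓝 0)) (h : ∀ n, |w (n + 1) - w n| ≤ b n - b (n + 1)) (n : ℕ) :
    |w n - L| ≤ b n := by
  have h1 : Antitone fun n => w n + b n :=
    antitone_nat_of_succ_le fun n => by have := (abs_le.1 (h n)).2; linarith
  have h2 : Monotone fun n => w n - b n :=
    monotone_nat_of_le_succ fun n => by have := (abs_le.1 (h n)).1; linarith
  have l1 := h1.le_of_tendsto (hw.add hb) n
  have l2 := h2.ge_of_tendsto (hw.sub hb) n
  rw [abs_le]
  constructor <;> linarith

/-- The increment of `1/(8(2n+1))` is exactly `-1/(4(2n+1)(2n+3))`, the main term of the increment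
of `normWindow`. -/
theorem abs_normWindow_sub_le (n : ℕ) :
    |normWindow n - 1 / (8 * (2 * n + 1)) - Real.log 2| ≤ 4 / ((n : ℝ) + 1) ^ 2 := by
  refine abs_sub_le_of_abs_succ_sub_le (w := fun n : ℕ => normWindow n - 1 / (8 * (2 * n + 1)))
    (b := fun n : ℕ => 4 / ((n : ℝ) + 1) ^ 2) ?_ ?_ (fun n => ?_) n
  · have h := tendsto_normWindow.sub ((tendsto_inv_two_mul_add 1).const_mul (1 / 8))
    rw [mul_zero, sub_zero] at h
    refine h.congr fun n => ?_
    field_simp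
  · have h := ((tendsto_one_div_add_atTop_nhds_zero_nat (𝕜 := ℝ)).pow 2).const_mul 4
    norm_num at h
    refine h.congr fun n => ?_
    field_simp
  · have e := abs_altRun_le n
    have hn : (0 : ℝ) ≤ n := by positivity
    simp only [normWindow_succ]
    push_cast
    rw [show normWindow n + (2 * altRun 0 (n + 1) - 1) / (2 * n + 3)
        - 1 / (8 * (2 * ((n : ℝ) + 1) + 1)) - (normWindow n - 1 / (8 * (2 * n + 1)))
        = (2 * altRun 0 (n + 1) - 1 + 1 / (4 * (2 * n + 1))) / (2 * n + 3) by field_simp; ring,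
      abs_div, abs_of_pos (a := 2 * (n : ℝ) + 3) (by positivity)]
    calc _ ≤ 8 / ((n : ℝ) + 3) ^ 2 / (2 * n + 3) := by gcongr
      _ ≤ 4 / ((n : ℝ) + 1) ^ 2 - 4 / ((n : ℝ) + 1 + 1) ^ 2 := by
        rw [← sub_nonneg]
        have : 4 / ((n : ℝ) + 1) ^ 2 - 4 / ((n : ℝ) + 1 + 1) ^ 2
            - 8 / ((n : ℝ) + 3) ^ 2 / (2 * n + 3) =
            (4 * (2 * n + 3) ^ 2 * (n + 3) ^ 2 - 8 * (n + 1) ^ 2 * (n + 2) ^ 2)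
              / ((n + 1) ^ 2 * (n + 2) ^ 2 * (n + 3) ^ 2 * (2 * n + 3)) := by
          field_simp; ring
        rw [this]
        refine div_nonneg ?_ (by positivity)
        ring_nf
        positivity

theorem expectedLength_succ (n : ℕ) :
    expectedLength (n + 1) =
      3 * ((n : ℝ) + 1) + 1 - (2 * n + 3) * normWindow (n + 1) - normWindow n := by
  rw [expectedLength_eq, expMoves, luckyMatches, normWindow, normWindow]
  push_cast
  field_simp
  ring

theorem abs_expectedLength_sub_le {n : ℕ} (hn : 0 < n) :
    |expectedLength n - ((3 - 2 * Real.log 2) * n + 7 / 8 - 2 * Real.log 2)| ≤ 13 / (n : ℝ) := by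
  obtain ⟨n, rfl⟩ := Nat.exists_eq_succ_of_ne_zero hn.ne'
  have h1 := abs_normWindow_sub_le (n + 1)
  have h2 := abs_normWindow_sub_le n
  rw [Nat.succ_eq_add_one, expectedLength_succ]
  push_cast at h1 ⊢
  have hn : (0 : ℝ) ≤ n := by positivity
  set a := normWindow (n + 1) - 1 / (8 * (2 * ((n : ℝ) + 1) + 1)) - Real.log 2 with ha
  set b := normWindow n - 1 / (8 * (2 * (n : ℝ) + 1)) - Real.log 2 with hb
  have e : 3 * ((n : ℝ) + 1) + 1 - (2 * n + 3) * normWindow (n + 1) - normWindow n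
      - ((3 - 2 * Real.log 2) * (n + 1) + 7 / 8 - 2 * Real.log 2)
      -- The constant `7/8` is `1 - 1/8`, where `1/8` is `2n + 3` times the correction
      -- `1/(8(2n+3))`.
      = -((2 * n + 3) * a + b + 1 / (8 * (2 * n + 1))) := by
    rw [ha, hb]; field_simp; ring
  rw [e, abs_neg]
  calc |(2 * (n : ℝ) + 3) * a + b + 1 / (8 * (2 * n + 1))|
      ≤ |(2 * (n : ℝ) + 3) * a| + |b| + |1 / (8 * (2 * (n : ℝ) + 1))| := abs_add_three _ _ _
    _ = (2 * (n : ℝ) + 3) * |a| + |b| + 1 / (8 * (2 * (n : ℝ) + 1)) := by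
        rw [abs_mul, abs_of_pos (a := 2 * (n : ℝ) + 3) (by positivity),
          abs_of_pos (a := 1 / (8 * (2 * (n : ℝ) + 1))) (by positivity)]
    _ ≤ (2 * (n : ℝ) + 3) * (4 / ((n : ℝ) + 1 + 1) ^ 2) + 4 / ((n : ℝ) + 1) ^ 2
          + 1 / (8 * (2 * (n : ℝ) + 1)) := by gcongr
    _ ≤ 8 / ((n : ℝ) + 1) + 4 / ((n : ℝ) + 1) + 1 / ((n : ℝ) + 1) := by
        gcongr ?_ + ?_ + ?_
        · rw [mul_div_assoc', div_le_div_iff₀ (by positivity) (by positivity)]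
          nlinarith
        · rw [div_le_div_iff₀ (by positivity) (by positivity)]
          nlinarith
        · rw [div_le_div_iff₀ (by positivity) (by positivity)]
          linarith
    _ = 13 / ((n : ℝ) + 1) := by ring

end SolitaireMemory

theorem mainTheorem3 :
    ∃ ε : ℕ → ℝ,
      (∀ n : ℕ, SolitaireMemory.expectedLength n =
        (3 - 2 * Real.log 2) * (n : ℝ) + 7 / 8 - 2 * Real.log 2 + ε n) ∧
      Filter.Tendsto ε Filter.atTop (nhds 0) ∧
      Asymptotics.IsBigO Filter.atTop ε (fun n : ℕ => 1 / Real.sqrt (n : ℝ)) := by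
  set ε : ℕ → ℝ := fun n =>
    SolitaireMemory.expectedLength n - ((3 - 2 * Real.log 2) * n + 7 / 8 - 2 * Real.log 2) with hε
  have hO : Asymptotics.IsBigO Filter.atTop ε (fun n : ℕ => 1 / Real.sqrt (n : ℝ)) := by
    refine Asymptotics.IsBigO.of_bound 13 ?_
    filter_upwards [Filter.eventually_gt_atTop 0] with n hn
    have hn1 : (1 : ℝ) ≤ n := by exact_mod_cast hn
    have hs : Real.sqrt n ≤ n := by
      exact Real.sqrt_le_iff.2 ⟨by linarith, by nlinarith⟩
    have hs0 : 0 < Real.sqrt n := Real.sqrt_pos.2 (by linarith)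
    rw [Real.norm_eq_abs, Real.norm_eq_abs, abs_of_pos (a := 1 / Real.sqrt n) (by positivity),
      mul_one_div]
    refine (SolitaireMemory.abs_expectedLength_sub_le hn).trans ?_
    gcongr
  refine ⟨ε, fun n => by rw [hε]; ring, hO.trans_tendsto ?_, hO⟩
  simp only [one_div]
  exact (Real.tendsto_sqrt_atTop.comp tendsto_natCast_atTop_atTop).inv_tendsto_atTop
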